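/- Let $X$ be a non-empty compact metric space, let $P(X)$ be the space of Borel probability measures on $X$ with the weak topology (equivalently, that of any $p$-Wasserstein distance, $1\le p<\infty$), let $\mu_0\in P(X)$, $\beta\in\mathbb R$, and let $d\ge 1$ be an integer. For $N\ge1$ let $\delta^{N}:X^{N}\to P(X)$, $\delta^{N}(x_1,\dots,x_N)=\frac1N\sum_{i=1}^N\delta_{x_i}$. For $\mu\in P(X)$ let $\mathrm{Ent}(\mu_0,\mu)=\int_X\log\frac{d\mu}{d\mu_0}\,d\mu\in[0,\infty]$ if $\mu\ll\mu_0$, and $\mathrm{Ent}(\mu_0,\mu)=\infty$ otherwise. Let $E:P(X)\to\mathbb R$ be continuous and let $H_{n^d}:X^{n^d}\to\mathbb R$ ($n\ge1$) be $\mu_0^{\otimes n^d}$-measurable functions (measurable with respect to the completion) with $$\lim_{n\to\infty}\Big\|\frac{H_{n^d}}{n^d}-E\circ\delta^{n^d}\Big\|_{L^\infty(X^{n^d})}=0,$$ where the $L^\infty$ norm is the essential supremum with respect to $\mu_0^{\otimes n^d}$ (this holds in particular if the convergence is uniform). Put $$Z_{\beta,n}=\int_{X^{n^d}}e^{-\beta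 H_{n^d}}\,d\mu_0^{\otimes n^d},\qquad \Gamma_{\beta,n}=\frac{1}{Z_{\beta,n}}\,\delta^{n^d}_\#\big(e^{-\beta H_{n^d}}\mu_0^{\otimes n^d}\big),$$ which is a probability measure on $P(X)$ for all sufficiently large $n$. Then the limit $$C_\beta=\lim_{n\to\infty}\frac1{n^d}\log Z_{\beta,n}$$ exists, is finite, and equals $-\inf_{\mu\in P(X)}\big[\beta E(\mu)+\mathrm{Ent}(\mu_0,\mu)\big]$. Moreover $(\Gamma_{\beta,n})_n$ satisfies the large deviation principle with speed $n^d$ and rate function $I=\beta E+\mathrm{Ent}(\mu_0,\cdot)+C_\beta$; that is, $I:P(X)\to[0,\infty]$ is lower semicontinuous and $$\liminf_{n\to\infty}\frac1{n^d}\log\Gamma_{\beta,n}(O)\ge-\inf_O I\ \text{ for every open } O\subset P(X),$$ $$\limsup_{n\to\infty}\frac1{n^d}\log\Gamma_{\beta,n}(C)\le-\inf_C I\ \text{ for every closed } C\subset P(X).$$ -/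

import Mathlib

open MeasureTheory Filter Topology
open scoped ENNReal NNReal

noncomputable section

namespace GibbsLDP

/-- `IsLDP μ r I`: the sequence of measures `μ n` on `𝒳` satisfies the large deviation principle
with normalization (speed) `r n ↗ ∞` and rate function `I`. The rate function takes values in
`[0, ∞]` (written inside `EReal`) and is lower semicontinuous; all but finitely many `μ n` are
probability measures. The logarithm is `ENNReal.log`, so `log 0 = -∞`, and the infimum over the
empty set is `+∞`. -/
structure IsLDP {𝒳 : Type*} [TopologicalSpace 𝒳] [MeasurableSpace 𝒳]
    (μ : ℕ → Measure 𝒳) (r : ℕ → ℝ) (I : 𝒳 → EReal) : Prop where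
  eventually_isProbabilityMeasure : ∀ᶠ n in atTop, IsProbabilityMeasure (μ n)
  speed_monotone : Monotone r
  speed_tendsto : Tendsto r atTop atTop
  rate_nonneg : ∀ x, 0 ≤ I x
  rate_lowerSemicontinuous : LowerSemicontinuous I
  lower_bound : ∀ O : Set 𝒳, IsOpen O →
    -(⨅ x ∈ O, I x) ≤ liminf (fun n => ((1 / r n : ℝ) : EReal) * ENNReal.log (μ n O)) atTop
  upper_bound : ∀ C : Set 𝒳, IsClosed C →
    limsup (fun n => ((1 / r n : ℝ) : EReal) * ENNReal.log (μ n C)) atTop ≤ -(⨅ x ∈ C, I x)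

variable {X : Type*} [MeasurableSpace X]

/-- The entropy `Ent(μ, ν) = ∫ log (dν/dμ) dν` of `ν` relative to `μ`, equal to `∞` if `ν` is not
absolutely continuous with respect to `μ`. -/
def Ent (μ ν : ProbabilityMeasure X) : ℝ≥0∞ :=
  InformationTheory.klDiv (ν : Measure X) (μ : Measure X)

theorem isProbabilityMeasure_empirical {N : ℕ} (hN : N ≠ 0) (x : Fin N → X) :
    IsProbabilityMeasure ((N : ℝ≥0∞)⁻¹ • ∑ i, Measure.dirac (x i)) := by
  constructor
  simp only [Measure.smul_apply, Measure.finsetSum_apply, measure_univ, Finset.sum_const,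
    Finset.card_univ, Fintype.card_fin, nsmul_eq_mul, mul_one, smul_eq_mul]
  exact ENNReal.inv_mul_cancel (by exact_mod_cast hN) (ENNReal.natCast_ne_top N)

/-- The empirical map `δ^N : X^N → P(X)`, `(x_1, …, x_N) ↦ (1/N) ∑ i, δ_{x_i}`, for `N ≥ 1`.
For `N = 0`, where there is no empirical measure, the value is an arbitrary Dirac mass. -/
def empirical [Nonempty X] (N : ℕ) (x : Fin N → X) : ProbabilityMeasure X :=
  if hN : N ≠ 0 then
    ⟨(N : ℝ≥0∞)⁻¹ • ∑ i, Measure.dirac (x i), isProbabilityMeasure_empirical hN x⟩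
  else
    ⟨Measure.dirac (Classical.arbitrary X), inferInstance⟩

/-- The product measure `μ₀^{⊗ N}` on `X^N`. -/
def prodMeasure (μ₀ : ProbabilityMeasure X) (N : ℕ) : Measure (Fin N → X) :=
  Measure.pi fun _ => (μ₀ : Measure X)

/-- The unnormalized Gibbs measure `e^{-β H} μ₀^{⊗ N}` on `X^N`. -/
def gibbsWeight (μ₀ : ProbabilityMeasure X) (β : ℝ) {N : ℕ} (H : (Fin N → X) → ℝ) :
    Measure (Fin N → X) :=
  (prodMeasure μ₀ N).withDensity fun x => ENNReal.ofReal (Real.exp (-β * H x))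

/-- The normalizing constant `Z = ∫_{X^N} e^{-β H} dμ₀^{⊗ N}`. -/
def partitionFunction (μ₀ : ProbabilityMeasure X) (β : ℝ) {N : ℕ} (H : (Fin N → X) → ℝ) :
    ℝ≥0∞ :=
  ∫⁻ x, ENNReal.ofReal (Real.exp (-β * H x)) ∂(prodMeasure μ₀ N)

/-- The law `Γ = δ^N_# (e^{-β H} μ₀^{⊗ N}) / Z` on `P(X)` of the empirical measure under the Gibbs
measure. The σ-algebra on `P(X)` is the one generated by the evaluations `ν ↦ ν A`; for a compact
metric space `X` it is the Borel σ-algebra of the weak topology. -/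
def gibbsEmpirical [Nonempty X] (μ₀ : ProbabilityMeasure X) (β : ℝ) {N : ℕ}
    (H : (Fin N → X) → ℝ) : Measure (ProbabilityMeasure X) :=
  (partitionFunction μ₀ β H)⁻¹ • (gibbsWeight μ₀ β H).map (empirical N)

end GibbsLDP

end

open ProbabilityTheory BoundedContinuousFunction

/-! Write `N = n ^ d` and `J = βE + Ent(μ₀, ·)`. As `P(X)` is compact, it suffices to control the
unnormalized laws near each `ν`: for `a < J ν` some neighbourhood has mass at most `e^{-Na}`
eventually, and for `a > J ν` every neighbourhood has mass at least `e^{-Na}` eventually. Finite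
covers then give the asymptotics of `Z`, and dividing by `Z` gives the LDP
(`isLDP_normalized_of_local_bounds`); lower semicontinuity of `J` also follows from the two bounds.

For `β = 0` the local bounds are Sanov's theorem. Lower bound: pass from `μ₀^{⊗N}` to `ν^{⊗N}`,
under which the law of large numbers puts the empirical measure near `ν` and the log-likelihood near
`N Ent(μ₀, ν)`. Upper bound: Donsker–Varadhan duality yields one bounded continuous `f` with `∫ f dν
- ∫ e^f dμ₀ + 1 > a`, and the Chernoff bound for `∑ f(x_i)` applies on an open half-space around
`ν`.

For general `β`, continuity of `E` and the `L^∞` convergence make `e^{-βH}` equal to `e^{-NβE(ν)}`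
up to a factor `e^{±2Nδ}` almost everywhere near `ν`. -/

theorem EReal.one_div_mul_log_le_iff {r : ℝ} (hr : 0 < r) (m : ℝ≥0∞) (y : ℝ) :
    ((1 / r : ℝ) : EReal) * ENNReal.log m ≤ (y : EReal) ↔
      m ≤ ENNReal.ofReal (Real.exp (r * y)) := by
  rw [← ENNReal.log_le_log_iff (x := m), ENNReal.log_ofReal_of_pos (Real.exp_pos _), Real.log_exp,
    mul_comm, ← EReal.le_div_iff_mul_le (by exact_mod_cast one_div_pos.2 hr)
      (EReal.coe_ne_top _), ← EReal.coe_div]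
  simp [mul_comm]

theorem EReal.le_one_div_mul_log_iff {r : ℝ} (hr : 0 < r) (m : ℝ≥0∞) (y : ℝ) :
    (y : EReal) ≤ ((1 / r : ℝ) : EReal) * ENNReal.log m ↔
      ENNReal.ofReal (Real.exp (r * y)) ≤ m := by
  rw [← ENNReal.log_le_log_iff (y := m), ENNReal.log_ofReal_of_pos (Real.exp_pos _), Real.log_exp,
    ← EReal.div_le_iff_le_mul (by exact_mod_cast one_div_pos.2 hr)
      (EReal.coe_ne_top _), ← EReal.coe_div]
  simp [mul_comm]

namespace GibbsLDP

/-- Exponential rates absorb constant factors. -/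
theorem eventually_const_mul_exp_le {r : ℕ → ℝ} (hr : Tendsto r atTop atTop) (K : ℝ) {a b : ℝ}
    (hab : b < a) : ∀ᶠ n in atTop, K * Real.exp (-(r n * a)) ≤ Real.exp (-(r n * b)) := by
  have h : Tendsto (fun n => Real.exp (r n * (a - b))) atTop atTop :=
    Real.tendsto_exp_atTop.comp (hr.atTop_mul_const (sub_pos.2 hab))
  filter_upwards [h.eventually_ge_atTop K] with n hn
  calc K * Real.exp (-(r n * a)) ≤ Real.exp (r n * (a - b)) * Real.exp (-(r n * a)) := by gcongr
    _ = Real.exp (-(r n * b)) := by rw [← Real.exp_add]; congr 1; ring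

/-! ### From local exponential bounds to a large deviation principle. -/

section LocalBounds

variable {P : Type*} [TopologicalSpace P] [MeasurableSpace P]
  {m : ℕ → Measure P} {r : ℕ → ℝ} {J : P → EReal}

/-- Exponential upper bounds near each point give exponential upper bounds on compact sets. -/
theorem eventually_measure_le_of_isCompact (hr : Tendsto r atTop atTop)
    (hup : ∀ x, ∀ a : ℝ, (a : EReal) < J x →
      ∃ U ∈ 𝓝 x, ∀ᶠ n in atTop, m n U ≤ ENNReal.ofReal (Real.exp (-(r n * a))))
    {C : Set P} (hC : IsCompact C) {a : ℝ} (ha : ∀ x ∈ C, (a : EReal) < J x) {b : ℝ} (hba : b < a) :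
    ∀ᶠ n in atTop, m n C ≤ ENNReal.ofReal (Real.exp (-(r n * b))) := by
  -- Quantifying over all `b < a` makes the property stable under unions: the factor 2 is absorbed
  -- by an intermediate rate.
  refine hC.induction_on (p := fun s => ∀ b < a,
    ∀ᶠ n in atTop, m n s ≤ ENNReal.ofReal (Real.exp (-(r n * b)))) ?_ ?_ ?_ ?_ b hba
  · intro b _
    simp
  · intro s t hst ht b hb
    filter_upwards [ht b hb] with n hn using (measure_mono hst).trans hn
  · intro s t hs ht b hb
    obtain ⟨c, hbc, hca⟩ := exists_between hb
    filter_upwards [hs c hca, ht c hca, eventually_const_mul_exp_le hr 2 hbc] with n h1 h2 h3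
    calc m n (s ∪ t) ≤ m n s + m n t := measure_union_le _ _
      _ ≤ ENNReal.ofReal (Real.exp (-(r n * c))) + ENNReal.ofReal (Real.exp (-(r n * c))) := by
        gcongr
      _ = ENNReal.ofReal (2 * Real.exp (-(r n * c))) := by
        rw [← ENNReal.ofReal_add (Real.exp_pos _).le (Real.exp_pos _).le, two_mul]
      _ ≤ _ := ENNReal.ofReal_le_ofReal h3
  · intro x hx
    obtain ⟨U, hU, h⟩ := hup x a (ha x hx)
    refine ⟨U, mem_nhdsWithin_of_mem_nhds hU, fun b hb => ?_⟩
    filter_upwards [h, hr.eventually_ge_atTop 0] with n hn h0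
    refine hn.trans (ENNReal.ofReal_le_ofReal (Real.exp_le_exp.2 ?_))
    nlinarith

/-- Matching local exponential bounds force the rate function to be lower semicontinuous. -/
theorem lowerSemicontinuous_of_local_bounds (hr : Tendsto r atTop atTop)
    (hup : ∀ x, ∀ a : ℝ, (a : EReal) < J x →
      ∃ U ∈ 𝓝 x, ∀ᶠ n in atTop, m n U ≤ ENNReal.ofReal (Real.exp (-(r n * a))))
    (hlow : ∀ x, ∀ a : ℝ, J x < (a : EReal) → ∀ U ∈ 𝓝 x,
      ∀ᶠ n in atTop, ENNReal.ofReal (Real.exp (-(r n * a))) ≤ m n U) :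
    LowerSemicontinuous J := by
  intro x y hy
  obtain ⟨a, hya, hax⟩ := EReal.lt_iff_exists_real_btwn.1 hy
  obtain ⟨c, hac, hcx⟩ := EReal.lt_iff_exists_real_btwn.1 hax
  obtain ⟨U, hU, h⟩ := hup x c hcx
  -- `U` is also a neighbourhood of every nearby `z`, so `J z < a` would force mass at least
  -- `e^{-ra}` where it is at most `e^{-rc}`, with `a < c`.
  filter_upwards [eventually_mem_nhds_iff.2 hU] with z hz
  refine hya.trans_le (not_lt.1 fun hza => ?_)
  obtain ⟨n, h1, h2, h3⟩ := (h.and ((hlow z a hza U hz).and (hr.eventually_gt_atTop 0))).exists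
  have h4 := (ENNReal.ofReal_le_ofReal_iff (Real.exp_pos _).le).1 (h2.trans h1)
  rw [Real.exp_le_exp] at h4
  have h5 : a < c := by exact_mod_cast hac
  nlinarith

/-- On a compact space, matching local exponential bounds for a sequence of finite measures give
the exponential asymptotics of the masses, and the large deviation principle after
normalization. -/
theorem isLDP_normalized_of_local_bounds [CompactSpace P] (hmono : Monotone r)
    (hr : Tendsto r atTop atTop)
    (hup : ∀ x, ∀ a : ℝ, (a : EReal) < J x →
      ∃ U ∈ 𝓝 x, ∀ᶠ n in atTop, m n U ≤ ENNReal.ofReal (Real.exp (-(r n * a))))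
    (hlow : ∀ x, ∀ a : ℝ, J x < (a : EReal) → ∀ U ∈ 𝓝 x,
      ∀ᶠ n in atTop, ENNReal.ofReal (Real.exp (-(r n * a))) ≤ m n U)
    {b : ℝ} (hb : (b : EReal) = ⨅ x, J x) :
    Tendsto (fun n => ((1 / r n : ℝ) : EReal) * ENNReal.log (m n Set.univ)) atTop
        (𝓝 ((-b : ℝ) : EReal)) ∧
      IsLDP (fun n => (m n Set.univ)⁻¹ • m n) r (fun x => J x + ((-b : ℝ) : EReal)) := by
  have hbJ : ∀ x, (b : EReal) ≤ J x := fun x => hb ▸ iInf_le _ x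
  have hZup : ∀ c : ℝ, c < b → ∀ᶠ n in atTop,
      m n Set.univ ≤ ENNReal.ofReal (Real.exp (-(r n * c))) := by
    intro c hc
    obtain ⟨c', h1, h2⟩ := exists_between hc
    exact eventually_measure_le_of_isCompact hr hup isCompact_univ
      (fun x _ => lt_of_lt_of_le (by exact_mod_cast h2) (hbJ x)) h1
  have hZlow : ∀ c : ℝ, b < c → ∀ᶠ n in atTop,
      ENNReal.ofReal (Real.exp (-(r n * c))) ≤ m n Set.univ := by
    intro c hc
    obtain ⟨x, hx⟩ := iInf_lt_iff.1 (hb ▸ (by exact_mod_cast hc : (b : EReal) < c))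
    exact hlow x c hx _ univ_mem
  have hshift : ∀ x (t : ℝ), (t : EReal) < J x + ((-b : ℝ) : EReal) ↔ ((t + b : ℝ) : EReal) < J x := by
    intro x t
    rw [EReal.coe_neg, ← sub_eq_add_neg, EReal.lt_sub_iff_add_lt (by simp) (by simp),
      EReal.coe_add]
  have hshift' : ∀ x (t : ℝ), J x + ((-b : ℝ) : EReal) < t ↔ J x < ((t + b : ℝ) : EReal) := by
    intro x t
    rw [EReal.coe_neg, ← sub_eq_add_neg, EReal.sub_lt_iff (by simp) (by simp),
      EReal.coe_add]
  refine ⟨?_, ?_, hmono, hr, ?_, ?_, ?_, ?_⟩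
  · rw [tendsto_order]
    constructor
    · intro y hy
      obtain ⟨z, hyz, hz⟩ := EReal.lt_iff_exists_real_btwn.1 hy
      have hz' : z < -b := by exact_mod_cast hz
      filter_upwards [hZlow (-z) (by linarith), hr.eventually_gt_atTop 0] with n h1 h2
      refine hyz.trans_le ((EReal.le_one_div_mul_log_iff h2 _ _).2 ?_)
      simpa using h1
    · intro y hy
      obtain ⟨z, hz, hyz⟩ := EReal.lt_iff_exists_real_btwn.1 hy
      have hz' : -b < z := by exact_mod_cast hz
      filter_upwards [hZup (-z) (by linarith), hr.eventually_gt_atTop 0] with n h1 h2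
      refine ((EReal.one_div_mul_log_le_iff h2 _ _).2 ?_).trans_lt hyz
      simpa using h1
  · filter_upwards [hZup (b - 1) (by linarith), hZlow (b + 1) (by linarith)] with n h1 h2
    constructor
    rw [Measure.smul_apply, smul_eq_mul]
    refine ENNReal.inv_mul_cancel ?_ (h1.trans_lt ENNReal.ofReal_lt_top).ne
    exact ((ENNReal.ofReal_pos.2 (Real.exp_pos _)).trans_le h2).ne'
  · intro x
    rw [EReal.coe_neg, ← sub_eq_add_neg]
    exact EReal.sub_nonneg (by simp) (by simp) |>.2 (hbJ x)
  · intro x y hy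
    obtain ⟨t, hyt, htx⟩ := EReal.lt_iff_exists_real_btwn.1 hy
    filter_upwards [lowerSemicontinuous_of_local_bounds hr hup hlow x _ ((hshift x t).1 htx)]
      with z hz using hyt.trans ((hshift z t).2 hz)
  · intro O hO
    refine le_of_forall_lt fun y hy => ?_
    obtain ⟨t, hyt, ht⟩ := EReal.lt_iff_exists_real_btwn.1 hy
    refine hyt.trans_le ?_
    rw [EReal.lt_neg_comm] at ht
    simp only [iInf_lt_iff] at ht
    obtain ⟨x, hxO, hx⟩ := ht
    obtain ⟨s, hxs, hst⟩ := EReal.lt_iff_exists_real_btwn.1 hx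
    have hst' : s < -t := by exact_mod_cast hst
    refine le_liminf_of_le (by isBoundedDefault) ?_
    -- Since `s + t < 0`, the total mass is at most `e^{-r(b+s+t)}`; times `e^{rt}` this is the
    -- lower bound `e^{-r(s+b)}` for `O`.
    filter_upwards [hlow x _ ((hshift' x s).1 hxs) O (hO.mem_nhds hxO), hr.eventually_gt_atTop 0,
      hZup (b + s + t) (by linarith), hZlow (b + 1) (by linarith)] with n h1 h2 h3 h4
    rw [EReal.le_one_div_mul_log_iff h2, Measure.smul_apply, smul_eq_mul, mul_comm (_)⁻¹,
      ← div_eq_mul_inv, ENNReal.le_div_iff_mul_le (Or.inl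
        ((ENNReal.ofReal_pos.2 (Real.exp_pos _)).trans_le h4).ne')
        (Or.inl (h3.trans_lt ENNReal.ofReal_lt_top).ne)]
    refine le_trans ?_ h1
    calc _ ≤ ENNReal.ofReal (Real.exp (r n * t))
          * ENNReal.ofReal (Real.exp (-(r n * (b + s + t)))) := by gcongr
      _ = _ := by
        rw [← ENNReal.ofReal_mul (Real.exp_pos _).le, ← Real.exp_add]
        congr 2; ring
  · intro C hC
    refine le_of_forall_gt fun y hy => ?_
    obtain ⟨t, ht, hty⟩ := EReal.lt_iff_exists_real_btwn.1 hy
    refine lt_of_le_of_lt ?_ hty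
    obtain ⟨s, hs, hst⟩ := EReal.lt_iff_exists_real_btwn.1 ht
    have hst' : s < t := by exact_mod_cast hst
    have hJ : ∀ x ∈ C, ((-s + b : ℝ) : EReal) < J x := by
      intro x hx
      rw [← hshift, EReal.coe_neg]
      exact (EReal.neg_lt_comm.1 hs).trans_le (iInf₂_le x hx)
    -- The gap from `s` to `u` pays for the finite cover, the gap from `u` to `t` for the
    -- normalization.
    obtain ⟨u, hsu, hut⟩ := exists_between hst'
    refine limsup_le_of_le (by isBoundedDefault) ?_
    filter_upwards [eventually_measure_le_of_isCompact hr hup hC.isCompact hJ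
        (b := -u + b) (by linarith), hr.eventually_gt_atTop 0,
      hZlow (b - u + t) (by linarith)] with n h1 h2 h4
    rw [EReal.one_div_mul_log_le_iff h2, Measure.smul_apply, smul_eq_mul, mul_comm (_)⁻¹,
      ← div_eq_mul_inv]
    refine ENNReal.div_le_of_le_mul (h1.trans ?_)
    calc ENNReal.ofReal (Real.exp (-(r n * (-u + b))))
        = ENNReal.ofReal (Real.exp (r n * t))
          * ENNReal.ofReal (Real.exp (-(r n * (b - u + t)))) := by
          rw [← ENNReal.ofReal_mul (Real.exp_pos _).le, ← Real.exp_add]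
          congr 2; ring
      _ ≤ _ := by gcongr

end LocalBounds

end GibbsLDP

namespace GibbsLDP

/-! ### Weak topology and evaluation σ-algebra. -/

section WeakTopology

variable {X : Type*} [MeasurableSpace X] [TopologicalSpace X] [OpensMeasurableSpace X]

/-- A filter of probability measures converges weakly as soon as it contains all the basic
neighbourhoods given by a single test function. -/
theorem le_nhds_of_forall_integral {ν : ProbabilityMeasure X} {F : Filter (ProbabilityMeasure X)}
    (h : ∀ f : X →ᵇ ℝ, ∀ ε > 0,
      {μ : ProbabilityMeasure X | |∫ x, f x ∂(μ : Measure X) - ∫ x, f x ∂(ν : Measure X)| < ε} ∈ F) :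
    F ≤ 𝓝 ν := by
  have : Tendsto id F (𝓝 ν) := by
    rw [ProbabilityMeasure.tendsto_iff_forall_integral_tendsto]
    intro f
    rw [Metric.tendsto_nhds]
    intro ε hε
    exact h f ε hε
  exact this

/-- The σ-algebra is generated by evaluations, so measurability is obtained from lower integrals of
the positive and negative parts, not from weak continuity. -/
theorem measurable_integral_boundedContinuous (f : X →ᵇ ℝ) :
    Measurable fun μ : ProbabilityMeasure X => ∫ x, f x ∂(μ : Measure X) := by
  have h : ∀ μ : ProbabilityMeasure X, ∫ x, f x ∂(μ : Measure X) =
      (∫⁻ x, ENNReal.ofReal (f x) ∂(μ : Measure X)).toReal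
        - (∫⁻ x, ENNReal.ofReal (-f x) ∂(μ : Measure X)).toReal := fun μ =>
    integral_eq_lintegral_pos_part_sub_lintegral_neg_part (f.integrable _)
  have hval : Measurable fun μ : ProbabilityMeasure X => (μ : Measure X) := measurable_subtype_coe
  simp_rw [h]
  refine Measurable.sub ?_ ?_
  · exact ((Measure.measurable_lintegral
      (ENNReal.measurable_ofReal.comp f.continuous.measurable)).comp hval).ennreal_toReal
  · exact ((Measure.measurable_lintegral
      (ENNReal.measurable_ofReal.comp f.continuous.neg.measurable)).comp hval).ennreal_toReal

theorem continuous_integral_boundedContinuous (f : X →ᵇ ℝ) :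
    Continuous fun μ : ProbabilityMeasure X => ∫ x, f x ∂(μ : Measure X) :=
  continuous_iff_continuousAt.2 fun μ =>
    ProbabilityMeasure.tendsto_iff_forall_integral_tendsto.1 (tendsto_id (x := 𝓝 μ)) f

/-- The weak topology has a basis of sets measurable for the evaluation σ-algebra. -/
theorem exists_measurableSet_mem_nhds {ν : ProbabilityMeasure X} {U : Set (ProbabilityMeasure X)}
    (hU : U ∈ 𝓝 ν) : ∃ V ⊆ U, MeasurableSet V ∧ V ∈ 𝓝 ν := by
  -- These sets form a filter, which reduces the claim to neighbourhoods given by one test function.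
  let F : Filter (ProbabilityMeasure X) :=
    { sets := {U | ∃ V ⊆ U, MeasurableSet V ∧ V ∈ 𝓝 ν}
      univ_sets := ⟨Set.univ, subset_rfl, MeasurableSet.univ, univ_mem⟩
      sets_of_superset := fun ⟨V, hV, h⟩ hst => ⟨V, hV.trans hst, h⟩
      inter_sets := fun ⟨V, hV, hVm, hVn⟩ ⟨W, hW, hWm, hWn⟩ =>
        ⟨V ∩ W, Set.inter_subset_inter hV hW, hVm.inter hWm, inter_mem hVn hWn⟩ }
  have hF : F ≤ 𝓝 ν := by
    refine le_nhds_of_forall_integral fun f ε hε => ⟨_, subset_rfl, ?_, ?_⟩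
    · exact measurableSet_lt ((measurable_integral_boundedContinuous f).sub_const _).abs
        measurable_const
    · refine IsOpen.mem_nhds ?_ (by simpa using hε)
      exact isOpen_lt ((continuous_integral_boundedContinuous f).sub continuous_const).abs
        continuous_const
  exact hF hU

end WeakTopology

/-! ### Empirical measures and laws of large numbers. -/

section Empirical

variable {X : Type*} [MeasurableSpace X]

instance (μ₀ : ProbabilityMeasure X) (N : ℕ) : IsProbabilityMeasure (prodMeasure μ₀ N) := by
  unfold prodMeasure; infer_instance

theorem coe_empirical [Nonempty X] {N : ℕ} (hN : N ≠ 0) (x : Fin N → X) :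
    (empirical N x : Measure X) = (N : ℝ≥0∞)⁻¹ • ∑ i, Measure.dirac (x i) := by
  have : empirical N x = ⟨_, isProbabilityMeasure_empirical hN x⟩ := dif_pos hN
  rw [this]
  rfl

theorem measurable_empirical [Nonempty X] (N : ℕ) : Measurable (empirical (X := X) N) := by
  by_cases hN : N ≠ 0
  · refine Measurable.subtype_mk (f := fun x => ((empirical N x : ProbabilityMeasure X) : Measure X))
      (h := fun x => (empirical N x).2) ?_
    refine Measure.measurable_of_measurable_coe _ fun s hs => ?_
    simp only [coe_empirical hN, Measure.smul_apply, Measure.finsetSum_apply, smul_eq_mul]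
    refine Measurable.const_mul (Finset.measurable_sum _ fun i _ => ?_) _
    simp_rw [Measure.dirac_apply' _ hs]
    exact (measurable_one.indicator hs).comp (measurable_pi_apply i)
  · have : empirical (X := X) N = fun _ => ⟨Measure.dirac (Classical.arbitrary X), inferInstance⟩ :=
      funext fun x => dif_neg hN
    rw [this]
    exact measurable_const

theorem integral_empirical [Nonempty X] {N : ℕ} (hN : N ≠ 0) (x : Fin N → X) {f : X → ℝ}
    (hf : Measurable f) : ∫ y, f y ∂(empirical N x : Measure X) = (∑ i, f (x i)) / N := by
  rw [coe_empirical hN, integral_smul_measure, integral_finsetSum_measure]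
  · simp [integral_dirac' _ _ hf.stronglyMeasurable, div_eq_inv_mul]
  · intro i _
    exact integrable_dirac' hf.stronglyMeasurable (by simp)

/-- The weak law of large numbers for integrable functions of i.i.d. points. -/
theorem tendsto_prodMeasure_average (ν : ProbabilityMeasure X) {h : X → ℝ} (hm : Measurable h)
    (hi : Integrable h (ν : Measure X)) {ε : ℝ} (hε : 0 < ε) :
    Tendsto (fun N : ℕ => prodMeasure ν N
      {x | ε ≤ |(∑ i, h (x i)) / N - ∫ y, h y ∂(ν : Measure X)|}) atTop (𝓝 0) := by
  -- The strong law needs all `N` on one space; `prodMeasure ν N` is the image of `P` under the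
  -- first `N` coordinates.
  let P : Measure (ℕ → X) := Measure.infinitePi fun _ => (ν : Measure X)
  have hmp : ∀ i, MeasurePreserving (fun ω : ℕ → X => ω i) P ν := fun i =>
    measurePreserving_eval_infinitePi _ i
  have hind : iIndepFun (fun (i : ℕ) (ω : ℕ → X) => h (ω i)) P :=
    iIndepFun_infinitePi (X := fun _ => h) fun _ => hm
  have hmean : ∫ ω, h (ω 0) ∂P = ∫ y, h y ∂(ν : Measure X) := by
    rw [← (hmp 0).map_eq, integral_map (hmp 0).measurable.aemeasurable hm.aestronglyMeasurable]
  have hslln := strong_law_ae_real (μ := P) (fun i ω => h (ω i)) ((hmp 0).integrable_comp_of_integrable hi)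
    (fun i j hij => hind.indepFun hij) (fun i =>
      ((IdentDistrib.mk (hmp i).measurable.aemeasurable (hmp 0).measurable.aemeasurable
        (by rw [(hmp i).map_eq, (hmp 0).map_eq])).comp hm))
  rw [hmean] at hslln
  have hmeas : ∀ N : ℕ, Measurable fun ω : ℕ → X => (∑ i ∈ Finset.range N, h (ω i)) / (N : ℝ) :=
    fun N => (Finset.measurable_sum _ fun i _ => hm.comp (measurable_pi_apply i)).div_const _
  have := tendstoInMeasure_iff_norm.1
    (tendstoInMeasure_of_tendsto_ae (fun N => (hmeas N).aestronglyMeasurable) hslln) ε hε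
  refine this.congr fun N => ?_
  have hmap : P.map (fun ω (i : Fin N) => ω i) = prodMeasure ν N := by
    rw [prodMeasure, ← Measure.infinitePi_eq_pi]
    exact Measure.map_infinitePi_infinitePi_of_inj Fin.val_injective
  rw [← hmap, Measure.map_apply (by fun_prop)]
  · congr 1
    ext ω
    simp [Finset.sum_range]
  · refine measurableSet_le measurable_const ?_
    exact (((Finset.measurable_sum _ fun i _ => hm.comp (measurable_pi_apply i)).div_const
      _).sub_const _).abs

/-- Empirical measures of i.i.d. points converge weakly, in probability. -/
theorem tendsto_prodMeasure_empirical_notMem [Nonempty X] [TopologicalSpace X]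
    [OpensMeasurableSpace X] (ν : ProbabilityMeasure X) {U : Set (ProbabilityMeasure X)}
    (hU : U ∈ 𝓝 ν) :
    Tendsto (fun N : ℕ => prodMeasure ν N {x | empirical N x ∉ U}) atTop (𝓝 0) := by
  let F : Filter (ProbabilityMeasure X) :=
    { sets := {U | Tendsto (fun N : ℕ => prodMeasure ν N {x | empirical N x ∉ U}) atTop (𝓝 0)}
      univ_sets := by simp
      sets_of_superset := fun {U V} hU hUV =>
        tendsto_of_tendsto_of_tendsto_of_le_of_le tendsto_const_nhds hU (fun _ => zero_le)
          fun N => measure_mono fun x hx hxU => hx (hUV hxU)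
      inter_sets := fun {U V} hU hV => by
        have h := Tendsto.add (show Tendsto _ _ _ from hU) (show Tendsto _ _ _ from hV)
        rw [add_zero] at h
        refine tendsto_of_tendsto_of_tendsto_of_le_of_le tendsto_const_nhds h (fun _ => zero_le)
          fun N => (measure_mono ?_).trans (measure_union_le _ _)
        intro x hx
        by_contra hcon
        simp only [Set.mem_union, Set.mem_ofPred_eq, not_or, not_not] at hcon
        exact hx hcon }
  have hF : F ≤ 𝓝 ν := by
    refine le_nhds_of_forall_integral fun f ε hε => ?_
    refine (tendsto_prodMeasure_average ν f.continuous.measurable (f.integrable _) hε).congr' ?_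
    filter_upwards [eventually_ne_atTop 0] with N hN
    congr 1
    ext x
    simp [integral_empirical hN x f.continuous.measurable]
  exact hF hU

end Empirical

/-! ### Sanov's lower bound by change of measure. -/

section ChangeOfMeasure

theorem pi_withDensity_eq_withDensity_prod {X ι : Type*} [MeasurableSpace X] [Fintype ι]
    (μ : Measure X) [IsProbabilityMeasure μ] {g : X → ℝ≥0∞} (hg : Measurable g)
    [SigmaFinite (μ.withDensity g)] :
    Measure.pi (fun _ : ι => μ.withDensity g) =
      (Measure.pi fun _ : ι => μ).withDensity fun x => ∏ i, g (x i) := by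
  refine Measure.pi_eq fun s hs => ?_
  rw [withDensity_apply _ (MeasurableSet.univ_pi hs), ← lintegral_indicator
    (MeasurableSet.univ_pi hs)]
  have h1 : ∀ x : ι → X, (Set.univ.pi s).indicator (fun x => ∏ i, g (x i)) x =
      ∏ i, (s i).indicator g (x i) := by
    intro x
    by_cases hx : x ∈ Set.univ.pi s
    · rw [Set.indicator_of_mem hx]
      exact Finset.prod_congr rfl fun i _ => (Set.indicator_of_mem (hx i trivial) g).symm
    · rw [Set.indicator_of_notMem hx]
      simp only [Set.mem_univ_pi, not_forall] at hx
      obtain ⟨i, hi⟩ := hx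
      exact (Finset.prod_eq_zero (Finset.mem_univ i) (Set.indicator_of_notMem hi g)).symm
  simp_rw [h1]
  have hind := iIndepFun_pi (μ := fun _ : ι => μ) (X := fun i => (s i).indicator g)
    fun i => (hg.indicator (hs i)).aemeasurable
  rw [lintegral_prod_eq_prod_lintegral_of_indepFun Finset.univ _ hind
    fun i => (hg.indicator (hs i)).comp (measurable_pi_apply i)]
  refine Finset.prod_congr rfl fun i _ => ?_
  rw [withDensity_apply _ (hs i), ← lintegral_indicator (hs i)]
  exact (measurePreserving_eval (fun _ : ι => μ) i).lintegral_comp (hg.indicator (hs i))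

variable {X : Type*} [MeasurableSpace X]

/-- Comparison of product measures on a set where the log-likelihood ratio is bounded. -/
theorem prodMeasure_le_exp_mul_prodMeasure {μ₀ ν : ProbabilityMeasure X}
    (hac : (ν : Measure X) ≪ μ₀) {N : ℕ} {A : Set (Fin N → X)} (hA : MeasurableSet A) {c : ℝ}
    (hc : ∀ x ∈ A, ∑ i, llr (ν : Measure X) μ₀ (x i) ≤ c) :
    prodMeasure ν N A ≤ ENNReal.ofReal (Real.exp c) * prodMeasure μ₀ N A := by
  let g : X → ℝ≥0∞ := fun x => ENNReal.ofReal ((ν : Measure X).rnDeriv μ₀ x).toReal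
  have hg : Measurable g := (Measure.measurable_rnDeriv _ _).ennreal_toReal.ennreal_ofReal
  have hν : (μ₀ : Measure X).withDensity g = ν := by
    rw [← Measure.withDensity_rnDeriv_eq _ _ hac]
    refine withDensity_congr_ae ?_
    filter_upwards [Measure.rnDeriv_lt_top (ν : Measure X) μ₀] with x hx
    exact ENNReal.ofReal_toReal hx.ne
  have : SigmaFinite ((μ₀ : Measure X).withDensity g) := hν ▸ inferInstance
  have hpi : prodMeasure ν N = (prodMeasure μ₀ N).withDensity fun x => ∏ i, g (x i) := by
    simp_rw [prodMeasure, ← pi_withDensity_eq_withDensity_prod _ hg, hν]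
  rw [hpi, withDensity_apply _ hA, ← setLIntegral_const]
  refine setLIntegral_mono measurable_const fun x hx => ?_
  rw [← ENNReal.ofReal_prod_of_nonneg fun i _ => ENNReal.toReal_nonneg]
  refine ENNReal.ofReal_le_ofReal ?_
  -- Where the density vanishes, `llr` is `log 0 = 0` and does not recover it; but then the whole
  -- product is zero.
  by_cases h0 : ∃ i, ((ν : Measure X).rnDeriv μ₀ (x i)).toReal = 0
  · obtain ⟨i, hi⟩ := h0
    rw [Finset.prod_eq_zero (Finset.mem_univ i) hi]
    exact (Real.exp_pos _).le
  · push Not at h0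
    refine le_trans (le_of_eq ?_) (Real.exp_le_exp.2 (hc x hx))
    rw [Real.exp_sum]
    exact Finset.prod_congr rfl fun i _ =>
      (Real.exp_log (lt_of_le_of_ne ENNReal.toReal_nonneg (h0 i).symm)).symm

variable [Nonempty X] [TopologicalSpace X] [OpensMeasurableSpace X]

/-- Local lower bound in Sanov's theorem. -/
theorem eventually_exp_le_prodMeasure_empirical_mem {μ₀ ν : ProbabilityMeasure X} {a : ℝ}
    (ha : (Ent μ₀ ν : EReal) < a) {U : Set (ProbabilityMeasure X)} (hU : U ∈ 𝓝 ν)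
    (hUm : MeasurableSet U) :
    ∀ᶠ N : ℕ in atTop, ENNReal.ofReal (Real.exp (-(N * a))) ≤
      prodMeasure μ₀ N (empirical N ⁻¹' U) := by
  have hfin : Ent μ₀ ν ≠ ∞ := by
    intro h
    simp [h] at ha
  obtain ⟨hac, hint⟩ := InformationTheory.klDiv_ne_top_iff.1 hfin
  set K : ℝ := ∫ y, llr (ν : Measure X) μ₀ y ∂(ν : Measure X) with hK
  have hKa : K < a := by
    have h1 : (Ent μ₀ ν).toReal = K :=
      InformationTheory.toReal_klDiv_of_measure_eq hac (by simp)
    rw [← ENNReal.ofReal_toReal hfin, h1, EReal.coe_ennreal_ofReal] at ha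
    exact (le_max_left _ _).trans_lt (by exact_mod_cast ha)
  obtain ⟨c, hKc, hca⟩ := exists_between hKa
  have hm : Measurable (llr (ν : Measure X) μ₀) := measurable_llr _ _
  have h1 := tendsto_prodMeasure_average ν hm hint (sub_pos.2 hKc)
  have h2 := tendsto_prodMeasure_empirical_notMem ν hU
  have h3 := h1.add h2
  rw [add_zero] at h3
  filter_upwards [h3.eventually_le_const (show (0 : ℝ≥0∞) < 2⁻¹ by simp), eventually_gt_atTop 0,
    eventually_const_mul_exp_le tendsto_natCast_atTop_atTop 2 hca] with N hN hN0 hexp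
  -- The typical set: its `ν^{⊗N}`-mass is at least 1/2, and `μ₀^{⊗N}` loses at most a factor
  -- `e^{Nc}` on it.
  let A : Set (Fin N → X) := empirical N ⁻¹' U ∩ {x | ∑ i, llr (ν : Measure X) μ₀ (x i) ≤ N * c}
  have hA : MeasurableSet A := (measurable_empirical N hUm).inter (measurableSet_le
    (Finset.measurable_sum _ fun i _ => hm.comp (measurable_pi_apply i)) measurable_const)
  have hAc : prodMeasure ν N Aᶜ ≤ 2⁻¹ := by
    refine le_trans ((measure_mono ?_).trans (measure_union_le _ _)) hN
    intro x hx
    by_contra hcon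
    simp only [Set.mem_union, Set.mem_ofPred_eq, not_or, not_not, not_le] at hcon
    refine hx ⟨hcon.2, ?_⟩
    have h4 := (abs_lt.1 hcon.1).2
    have h5 : (∑ i, llr (ν : Measure X) μ₀ (x i)) / N < c := by linarith
    rw [div_lt_iff₀ (by exact_mod_cast hN0), mul_comm] at h5
    exact h5.le
  have hA2 : 2⁻¹ ≤ prodMeasure ν N A := by
    have h6 := prob_add_prob_compl (μ := prodMeasure ν N) hA
    have h7 : (2⁻¹ : ℝ≥0∞) + 2⁻¹ ≤ prodMeasure ν N A + 2⁻¹ := by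
      rw [ENNReal.inv_two_add_inv_two, ← h6]
      gcongr
    exact (ENNReal.add_le_add_iff_right (by simp)).1 h7
  have h8 := hA2.trans (prodMeasure_le_exp_mul_prodMeasure hac hA (c := N * c) fun x hx => hx.2)
  calc ENNReal.ofReal (Real.exp (-(N * a)))
      ≤ ENNReal.ofReal (Real.exp (-(N * c)) * 2⁻¹) := ENNReal.ofReal_le_ofReal (by
        linarith)
    _ = ENNReal.ofReal (Real.exp (-(N * c))) * 2⁻¹ := by
        rw [ENNReal.ofReal_mul (Real.exp_pos _).le]
        congr 1
        rw [ENNReal.ofReal_inv_of_pos two_pos]; simp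
    _ ≤ ENNReal.ofReal (Real.exp (-(N * c))) *
        (ENNReal.ofReal (Real.exp (N * c)) * prodMeasure μ₀ N A) := by gcongr
    _ = prodMeasure μ₀ N A := by
        rw [← mul_assoc, ← ENNReal.ofReal_mul (Real.exp_pos _).le, ← Real.exp_add]
        simp
    _ ≤ _ := measure_mono Set.inter_subset_left

end ChangeOfMeasure

end GibbsLDP

namespace GibbsLDP

/-! ### Donsker–Varadhan duality. -/

section DonskerVaradhan

open InformationTheory

/-- `t ∈ [0, ∞)` truncated to `[1 / (n + 1), n + 1]`. -/
noncomputable def truncate (n : ℕ) (t : ℝ) : ℝ := max (min t (n + 1)) (1 / (n + 1))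

theorem truncate_pos (n : ℕ) (t : ℝ) : 0 < truncate n t :=
  lt_of_lt_of_le (by positivity) (le_max_right _ _)

theorem measurable_truncate (n : ℕ) : Measurable (truncate n) := by
  unfold truncate; fun_prop

theorem truncate_le (n : ℕ) (t : ℝ) : truncate n t ≤ n + 1 := by
  refine max_le (min_le_right _ _) ?_
  rw [div_le_iff₀ (by positivity)]
  nlinarith [(Nat.cast_nonneg n : (0 : ℝ) ≤ n)]

theorem abs_log_truncate_le (n : ℕ) (t : ℝ) : |Real.log (truncate n t)| ≤ Real.log (n + 1) := by
  rw [abs_le]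
  constructor
  · rw [← Real.log_inv, ← one_div]
    exact Real.log_le_log (by positivity) (le_max_right _ _)
  · exact Real.log_le_log (truncate_pos n t) (truncate_le n t)

theorem tendsto_truncate {t : ℝ} (ht : 0 ≤ t) : Tendsto (fun n => truncate n t) atTop (𝓝 t) := by
  have h1 : Tendsto (fun n : ℕ => min t ((n : ℝ) + 1)) atTop (𝓝 t) := by
    refine tendsto_const_nhds.congr' ?_
    filter_upwards [tendsto_natCast_atTop_atTop.eventually_ge_atTop t] with n hn
    exact (min_eq_left (by linarith)).symm
  simpa [truncate, max_eq_left ht] using h1.max (tendsto_one_div_add_atTop_nhds_zero_nat (𝕜 := ℝ))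

/-- With `s = truncate n t`, the expression is `klFun s + (t - s) log s`. Truncation only moves `t`
towards 1, so `t - s` and `log s` never have opposite signs. This positivity is what Fatou's lemma
needs. -/
theorem mul_log_truncate_nonneg (n : ℕ) (t : ℝ) :
    0 ≤ t * Real.log (truncate n t) - truncate n t + 1 := by
  have h1 : 0 ≤ klFun (truncate n t) := klFun_nonneg (truncate_pos n t).le
  have h2 : 0 ≤ (t - truncate n t) * Real.log (truncate n t) := by
    have hn : (0 : ℝ) ≤ n := Nat.cast_nonneg n
    have h3 : 1 / ((n : ℝ) + 1) ≤ 1 := by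
      rw [div_le_iff₀ (by positivity)]; linarith
    rcases le_total t (truncate n t) with h | h
    · rcases h.eq_or_lt with h | h
      · simp [← h]
      · refine mul_nonneg_of_nonpos_of_nonpos (by linarith)
          (Real.log_nonpos (truncate_pos n t).le ?_)
        rcases max_choice (min t ((n : ℝ) + 1)) (1 / (n + 1)) with h4 | h4
        · rw [truncate, h4] at h
          exact absurd (min_le_left _ _) (not_le.2 h)
        · rw [truncate, h4]; exact h3
    · rcases h.eq_or_lt with h | h
      · simp [h]
      · refine mul_nonneg (by linarith) (Real.log_nonneg ?_)
        by_contra hlt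
        have h5 : min t ((n : ℝ) + 1) < 1 := (le_max_left _ _).trans_lt (not_le.1 hlt)
        rcases min_choice t ((n : ℝ) + 1) with h6 | h6
        · have h7 : min t ((n : ℝ) + 1) ≤ truncate n t := le_max_left _ _
          rw [h6] at h7
          exact absurd h7 (not_le.2 h)
        · linarith
  rw [klFun_apply] at h1
  linarith

/-- At `t = 0` the logarithm diverges, but its coefficient is zero for every `n`. -/
theorem tendsto_mul_log_truncate {t : ℝ} (ht : 0 ≤ t) :
    Tendsto (fun n => t * Real.log (truncate n t) - truncate n t + 1) atTop (𝓝 (klFun t)) := by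
  have h1 := tendsto_truncate ht
  have h2 : Tendsto (fun n => t * Real.log (truncate n t)) atTop (𝓝 (t * Real.log t)) := by
    rcases ht.eq_or_lt with h | h
    · simp [← h]
    · exact ((Real.continuousAt_log h.ne').tendsto.comp h1).const_mul t
  rw [klFun_apply, show t * Real.log t + 1 - t = t * Real.log t - t + 1 by ring]
  exact (h2.sub h1).add_const 1

variable {X : Type*} [MeasurableSpace X]

/-- The Donsker–Varadhan lower bound for the entropy, tested on bounded measurable functions. -/
theorem exists_bounded_measurable_lt {μ₀ ν : ProbabilityMeasure X} {a : ℝ}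
    (ha : (a : EReal) < (Ent μ₀ ν : EReal)) :
    ∃ (f : X → ℝ) (M : ℝ), Measurable f ∧ (∀ x, |f x| ≤ M) ∧
      a < ∫ x, f x ∂(ν : Measure X) - ∫ x, Real.exp (f x) ∂(μ₀ : Measure X) + 1 := by
  rcases lt_or_ge a 0 with ha0 | ha0
  · exact ⟨0, 0, measurable_zero, by simp, by simpa using ha0⟩
  by_cases hac : (ν : Measure X) ≪ μ₀
  · have hklDiv : ENNReal.ofReal a < Ent μ₀ ν := by
      rw [← EReal.coe_ennreal_lt_coe_ennreal_iff, EReal.coe_ennreal_ofReal, max_eq_left ha0]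
      exact ha
    set g : X → ℝ := fun x => ((ν : Measure X).rnDeriv μ₀ x).toReal with hg
    have hgm : Measurable g := (Measure.measurable_rnDeriv _ _).ennreal_toReal
    have hg0 : ∀ x, 0 ≤ g x := fun x => ENNReal.toReal_nonneg
    let φ : ℕ → X → ℝ := fun n x => g x * Real.log (truncate n (g x)) - truncate n (g x) + 1
    have hcm : ∀ n, Measurable fun x => truncate n (g x) := fun n => (measurable_truncate n).comp hgm
    have hfm : ∀ n, Measurable fun x => Real.log (truncate n (g x)) := fun n =>
      Real.measurable_log.comp (hcm n)
    have hφm : ∀ n, Measurable (φ n) := fun n =>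
      ((hgm.mul (hfm n)).sub (hcm n)).add_const 1
    -- The optimal test function `log(dν/dμ₀)` may be unbounded; Fatou shows that its truncations
    -- lose nothing in the limit.
    have hfatou : Ent μ₀ ν ≤ liminf (fun n => ∫⁻ x, ENNReal.ofReal (φ n x) ∂(μ₀ : Measure X)) atTop := by
      rw [Ent, klDiv_eq_lintegral_klFun_of_ac hac]
      refine le_trans (le_of_eq (lintegral_congr fun x => ?_))
        (lintegral_liminf_le fun n => (hφm n).ennreal_ofReal)
      exact ((ENNReal.tendsto_ofReal (tendsto_mul_log_truncate (hg0 x))).liminf_eq).symm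
    obtain ⟨n, hn⟩ := (eventually_lt_of_lt_liminf (hklDiv.trans_le hfatou)).exists
    have hgi : Integrable g (μ₀ : Measure X) := Measure.integrable_toReal_rnDeriv
    have hgf : Integrable (fun x => g x * Real.log (truncate n (g x))) (μ₀ : Measure X) :=
      hgi.mul_bdd (c := Real.log (n + 1)) (hfm n).aestronglyMeasurable
        (ae_of_all _ fun x => abs_log_truncate_le n _)
    have hci : Integrable (fun x => truncate n (g x)) (μ₀ : Measure X) :=
      Integrable.of_bound (hcm n).aestronglyMeasurable (n + 1) (ae_of_all _ fun x => by
        rw [Real.norm_of_nonneg (truncate_pos n _).le]; exact truncate_le n _)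
    refine ⟨fun x => Real.log (truncate n (g x)), Real.log (n + 1), hfm n,
      fun x => abs_log_truncate_le n _, ?_⟩
    have hφi : Integrable (φ n) (μ₀ : Measure X) := (hgf.sub hci).add (integrable_const 1)
    rw [← ofReal_integral_eq_lintegral_ofReal hφi
      (ae_of_all _ fun x => mul_log_truncate_nonneg n _),
      ENNReal.ofReal_lt_ofReal_iff_of_nonneg ha0] at hn
    refine hn.trans_le (le_of_eq ?_)
    simp_rw [Real.exp_log (truncate_pos n _)]
    rw [← integral_rnDeriv_smul hac]
    change ∫ x, (g x * Real.log (truncate n (g x)) - truncate n (g x) + 1) ∂(μ₀ : Measure X) = _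
    rw [integral_add (f := fun x => g x * Real.log (truncate n (g x)) - truncate n (g x))
      (hgf.sub hci) (integrable_const 1), integral_sub hgf hci]
    simp [hg]
  · obtain ⟨A, hA, hA0, hνA⟩ : ∃ A, MeasurableSet A ∧ (μ₀ : Measure X) A = 0 ∧
        (ν : Measure X) A ≠ 0 := by
      by_contra! h
      exact hac (Measure.AbsolutelyContinuous.mk fun s hs hs0 => h s hs hs0)
    have hpos : 0 < (ν : Measure X).real A := ENNReal.toReal_pos hνA (measure_ne_top _ _)
    -- A multiple of the indicator of `A` is invisible to `μ₀`; this height makes the functional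
    -- equal to `a + 1`.
    set t : ℝ := (a + 1) / (ν : Measure X).real A with ht
    refine ⟨A.indicator fun _ => t, |t|, measurable_const.indicator hA, fun x => ?_, ?_⟩
    · by_cases hx : x ∈ A <;> simp [hx]
    · have h1 : ∫ x, A.indicator (fun _ => t) x ∂(ν : Measure X) = a + 1 := by
        rw [integral_indicator_const _ hA, smul_eq_mul, ht, mul_div_cancel₀ _ hpos.ne']
      have h2 : ∫ x, Real.exp (A.indicator (fun _ => t) x) ∂(μ₀ : Measure X) = 1 := by
        have : (fun x => Real.exp (A.indicator (fun _ => t) x)) =ᵐ[(μ₀ : Measure X)] fun _ => 1 := by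
          filter_upwards [measure_eq_zero_iff_ae_notMem.1 hA0] with x hx
          simp [hx]
        rw [integral_congr_ae this]
        simp
      rw [h1, h2]
      linarith

theorem abs_exp_sub_exp_le {M s t : ℝ} (hs : s ≤ M) (ht : t ≤ M) :
    |Real.exp s - Real.exp t| ≤ Real.exp M * |s - t| := by
  wlog h : t ≤ s generalizing s t
  · rw [abs_sub_comm, abs_sub_comm s]
    exact this ht hs (le_of_not_ge h)
  rw [abs_of_nonneg (sub_nonneg.2 (Real.exp_le_exp.2 h)), abs_of_nonneg (sub_nonneg.2 h)]
  have h1 : Real.exp t = Real.exp s * Real.exp (t - s) := by rw [← Real.exp_add]; ring_nf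
  have h2 := Real.add_one_le_exp (t - s)
  calc Real.exp s - Real.exp t = Real.exp s * (1 - Real.exp (t - s)) := by rw [h1]; ring
    _ ≤ Real.exp s * (s - t) := mul_le_mul_of_nonneg_left (by linarith) (Real.exp_pos _).le
    _ ≤ Real.exp M * (s - t) := by gcongr

/-- The Donsker–Varadhan lower bound for the entropy, tested on bounded continuous functions. -/
theorem exists_boundedContinuous_lt [TopologicalSpace X] [TopologicalSpace.PseudoMetrizableSpace X]
    [BorelSpace X] {μ₀ ν : ProbabilityMeasure X} {a : ℝ} (ha : (a : EReal) < (Ent μ₀ ν : EReal)) :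
    ∃ f : X →ᵇ ℝ,
      a < ∫ x, f x ∂(ν : Measure X) - ∫ x, Real.exp (f x) ∂(μ₀ : Measure X) + 1 := by
  obtain ⟨f, M, hfm, hfM, hf⟩ := exists_bounded_measurable_lt ha
  set D := ∫ x, f x ∂(ν : Measure X) - ∫ x, Real.exp (f x) ∂(μ₀ : Measure X) + 1 with hD
  -- An `L¹` error `η` costs `η` in the `ν`-integral and `e^M η` in the exponential one: together
  -- half of `D - a`.
  set η := (D - a) / (2 * (1 + Real.exp M)) with hη
  have hη0 : 0 < η := div_pos (by linarith) (by positivity)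
  have hfi : ∀ (μ : Measure X) [IsFiniteMeasure μ], Integrable f μ := fun μ _ =>
    Integrable.of_bound hfm.aestronglyMeasurable M (ae_of_all _ hfM)
  -- Approximating in `L¹(μ₀ + ν)` controls both errors at once. Clamping `g` to `[-M, M]` then
  -- gives the bound needed for `exp` without moving it away from `f`.
  obtain ⟨g, hg, -⟩ := (hfi ((μ₀ : Measure X) + ν)).exists_boundedContinuous_integral_sub_le hη0
  have hM : ∀ x, -M ≤ f x ∧ f x ≤ M := fun x => abs_le.1 (hfM x)
  have hM' : ∀ x : X, -M ≤ M := fun x => (hM x).1.trans (hM x).2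
  have hbd : ∀ x, ‖max (-M) (min M (g x))‖ ≤ M := fun x =>
    abs_le.2 ⟨le_max_left _ _, max_le (hM' x) (min_le_left _ _)⟩
  let h : X →ᵇ ℝ := BoundedContinuousFunction.ofNormedAddCommGroup
    (fun x => max (-M) (min M (g x))) (by fun_prop) M hbd
  have hhM : ∀ x, h x ≤ M := fun x => (abs_le.1 (hbd x)).2
  have hfh : ∀ x, |f x - h x| ≤ ‖f x - g x‖ := by
    intro x
    have h1 : f x = max (-M) (min M (f x)) := by
      rw [min_eq_right (hM x).2, max_eq_right (hM x).1]
    calc |f x - h x| = |max (-M) (min M (f x)) - max (-M) (min M (g x))| := by rw [← h1]; rfl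
      _ ≤ |min M (f x) - min M (g x)| := abs_max_sub_max_le_abs _ _ _ |>.trans_eq' (by
          rw [max_comm, max_comm (-M) (min M (g x))])
      _ ≤ ‖f x - g x‖ := by
          have := abs_min_sub_min_le_max M (f x) M (g x)
          simpa using this
  have hgi : ∀ (μ : Measure X) [IsFiniteMeasure μ], Integrable (fun x => ‖f x - g x‖) μ :=
    fun μ _ => ((hfi μ).sub (g.integrable μ)).norm
  have hle : ∀ μ ∈ ({(μ₀ : Measure X), (ν : Measure X)} : Set (Measure X)),
      ∫ x, ‖f x - g x‖ ∂μ ≤ η := by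
    rw [integral_add_measure (hgi _) (hgi _)] at hg
    have h1 : 0 ≤ ∫ x, ‖f x - g x‖ ∂(μ₀ : Measure X) := integral_nonneg fun _ => norm_nonneg _
    have h2 : 0 ≤ ∫ x, ‖f x - g x‖ ∂(ν : Measure X) := integral_nonneg fun _ => norm_nonneg _
    rintro μ (rfl | rfl) <;> linarith
  have hν : ∫ x, f x ∂(ν : Measure X) - ∫ x, h x ∂(ν : Measure X) ≤ η := by
    rw [← integral_sub (hfi _) (h.integrable _)]
    refine (integral_mono ((hfi _).sub (h.integrable _)) (hgi _) fun x => ?_).trans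
      (hle _ (by simp))
    exact (le_abs_self _).trans (hfh x)
  have hexpf : Integrable (fun x => Real.exp (f x)) (μ₀ : Measure X) :=
    Integrable.of_bound (Real.measurable_exp.comp hfm).aestronglyMeasurable (Real.exp M)
      (ae_of_all _ fun x => by
        rw [Real.norm_of_nonneg (Real.exp_pos _).le]; exact Real.exp_le_exp.2 (hM x).2)
  have hexph : Integrable (fun x => Real.exp (h x)) (μ₀ : Measure X) :=
    Integrable.of_bound (Real.measurable_exp.comp h.continuous.measurable).aestronglyMeasurable
      (Real.exp M) (ae_of_all _ fun x => by
        rw [Real.norm_of_nonneg (Real.exp_pos _).le]; exact Real.exp_le_exp.2 (hhM x))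
  have hμ₀ : ∫ x, Real.exp (h x) ∂(μ₀ : Measure X) - ∫ x, Real.exp (f x) ∂(μ₀ : Measure X)
      ≤ Real.exp M * η := by
    rw [← integral_sub hexph hexpf]
    refine (integral_mono (hexph.sub hexpf) ((hgi _).const_mul (Real.exp M)) fun x => ?_).trans ?_
    · refine (le_abs_self _).trans ((abs_exp_sub_exp_le (hhM x) (hM x).2).trans ?_)
      rw [abs_sub_comm]
      exact mul_le_mul_of_nonneg_left (hfh x) (Real.exp_pos _).le
    · rw [integral_const_mul]
      exact mul_le_mul_of_nonneg_left (hle _ (by simp)) (Real.exp_pos _).le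
  have hη2 : η + Real.exp M * η = (D - a) / 2 := by
    rw [hη]
    have : 1 + Real.exp M ≠ 0 := by positivity
    field_simp
  exact ⟨h, by linarith⟩

end DonskerVaradhan

/-! ### Sanov's upper bound by Chernoff's inequality. -/

section LocalUpperBound

variable {X : Type*} [MeasurableSpace X]

/-- Chernoff bound for sums of i.i.d. bounded random variables. -/
theorem prodMeasure_le_sum_le (μ₀ : ProbabilityMeasure X) {f : X → ℝ} (hf : Measurable f)
    (hi : Integrable (fun x => Real.exp (f x)) (μ₀ : Measure X)) (N : ℕ) (c : ℝ) :
    prodMeasure μ₀ N {x | c ≤ ∑ i, f (x i)} ≤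
      ENNReal.ofReal (Real.exp (N * (∫ x, Real.exp (f x) ∂(μ₀ : Measure X) - 1) - c)) := by
  let G : X → ℝ≥0∞ := fun x => ENNReal.ofReal (Real.exp (f x))
  have hG : Measurable G := (Real.measurable_exp.comp hf).ennreal_ofReal
  have hprod : ∫⁻ x, ∏ i, G (x i) ∂(prodMeasure μ₀ N) ≤
      ENNReal.ofReal (Real.exp (N * (∫ x, Real.exp (f x) ∂(μ₀ : Measure X) - 1))) := by
    have hind := iIndepFun_pi (μ := fun _ : Fin N => (μ₀ : Measure X)) (X := fun _ => G)
      fun _ => hG.aemeasurable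
    rw [prodMeasure, lintegral_prod_eq_prod_lintegral_of_indepFun Finset.univ _ hind
      fun i => hG.comp (measurable_pi_apply i)]
    have h1 : ∀ i : Fin N, ∫⁻ x, G (x i) ∂(Measure.pi fun _ => (μ₀ : Measure X)) =
        ENNReal.ofReal (∫ x, Real.exp (f x) ∂(μ₀ : Measure X)) := fun i => by
      rw [(measurePreserving_eval (fun _ : Fin N => (μ₀ : Measure X)) i).lintegral_comp hG,
        ofReal_integral_eq_lintegral_ofReal hi (ae_of_all _ fun x => (Real.exp_pos _).le)]
    simp_rw [h1]
    rw [Finset.prod_const, Finset.card_univ, Fintype.card_fin, Real.exp_nat_mul,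
      ENNReal.ofReal_pow (Real.exp_pos _).le]
    gcongr
    -- The inequality `I ≤ e^{I-1}` matches the linear term `-∫ e^f dμ₀ + 1` of the duality.
    linarith [Real.add_one_le_exp (∫ x, Real.exp (f x) ∂(μ₀ : Measure X) - 1)]
  have hset : {x : Fin N → X | c ≤ ∑ i, f (x i)} ⊆
      {x | ENNReal.ofReal (Real.exp c) ≤ ∏ i, G (x i)} := by
    intro x hx
    simp only [G, Set.mem_ofPred_eq] at hx ⊢
    rw [← ENNReal.ofReal_prod_of_nonneg fun i _ => (Real.exp_pos _).le, ← Real.exp_sum]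
    exact ENNReal.ofReal_le_ofReal (Real.exp_le_exp.2 hx)
  have hmarkov := mul_meas_ge_le_lintegral (μ := prodMeasure μ₀ N)
    (f := fun x : Fin N → X => ∏ i, G (x i))
    (Finset.measurable_prod _ fun i _ => hG.comp (measurable_pi_apply i))
    (ENNReal.ofReal (Real.exp c))
  rw [Real.exp_sub, ENNReal.ofReal_div_of_pos (Real.exp_pos _),
    ENNReal.le_div_iff_mul_le (Or.inl (by simp [Real.exp_pos])) (Or.inl (by simp)), mul_comm]
  exact le_trans (by gcongr) (hmarkov.trans hprod)

/-- Local upper bound in Sanov's theorem. -/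
theorem exists_nhds_prodMeasure_empirical_le [Nonempty X] [TopologicalSpace X]
    [TopologicalSpace.PseudoMetrizableSpace X] [BorelSpace X] {μ₀ ν : ProbabilityMeasure X} {a : ℝ}
    (ha : (a : EReal) < (Ent μ₀ ν : EReal)) :
    ∃ U ∈ 𝓝 ν, ∀ N : ℕ, N ≠ 0 →
      prodMeasure μ₀ N (empirical N ⁻¹' U) ≤ ENNReal.ofReal (Real.exp (-(N * a))) := by
  obtain ⟨f, hf⟩ := exists_boundedContinuous_lt ha
  set L := ∫ x, Real.exp (f x) ∂(μ₀ : Measure X) - 1 with hL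
  refine ⟨{μ | a + L < ∫ x, f x ∂(μ : Measure X)}, IsOpen.mem_nhds
    (isOpen_lt continuous_const (continuous_integral_boundedContinuous f)) ?_, fun N hN => ?_⟩
  · change a + L < _
    linarith
  · have hi : Integrable (fun x => Real.exp (f x)) (μ₀ : Measure X) :=
      Integrable.of_bound (Real.measurable_exp.comp f.continuous.measurable).aestronglyMeasurable
        (Real.exp ‖f‖) (ae_of_all _ fun x => by
          rw [Real.norm_of_nonneg (Real.exp_pos _).le]
          exact Real.exp_le_exp.2 ((le_abs_self _).trans (f.norm_coe_le_norm x)))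
    refine (measure_mono ?_).trans ((prodMeasure_le_sum_le μ₀ f.continuous.measurable hi N
      (N * (a + L))).trans (le_of_eq ?_))
    · intro x hx
      have h1 : a + L < (∑ i, f (x i)) / N := by
        rw [← integral_empirical hN x f.continuous.measurable]; exact hx
      rw [lt_div_iff₀ (by positivity), mul_comm] at h1
      exact h1.le
    · congr 2
      rw [← hL]; ring

end LocalUpperBound

end GibbsLDP

namespace GibbsLDP

/-! ### Tilting by the Gibbs factor. -/

section Tilting

variable {X : Type*} [MeasurableSpace X]

theorem gibbsWeight_le_exp_mul {μ₀ : ProbabilityMeasure X} {β : ℝ} {N : ℕ} {H : (Fin N → X) → ℝ}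
    {A : Set (Fin N → X)} (hA : MeasurableSet A) {t : ℝ}
    (h : ∀ᵐ x ∂prodMeasure μ₀ N, x ∈ A → -β * H x ≤ t) :
    gibbsWeight μ₀ β H A ≤ ENNReal.ofReal (Real.exp t) * prodMeasure μ₀ N A := by
  rw [gibbsWeight, withDensity_apply _ hA, ← setLIntegral_const]
  refine setLIntegral_mono_ae' hA ?_
  filter_upwards [h] with x hx hxA
  exact ENNReal.ofReal_le_ofReal (Real.exp_le_exp.2 (hx hxA))

theorem exp_mul_le_gibbsWeight {μ₀ : ProbabilityMeasure X} {β : ℝ} {N : ℕ} {H : (Fin N → X) → ℝ}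
    {A : Set (Fin N → X)} (hA : MeasurableSet A) {t : ℝ}
    (h : ∀ᵐ x ∂prodMeasure μ₀ N, x ∈ A → t ≤ -β * H x) :
    ENNReal.ofReal (Real.exp t) * prodMeasure μ₀ N A ≤ gibbsWeight μ₀ β H A := by
  rw [gibbsWeight, withDensity_apply _ hA, ← setLIntegral_const]
  refine setLIntegral_mono_ae' hA ?_
  filter_upwards [h] with x hx hxA
  exact ENNReal.ofReal_le_ofReal (Real.exp_le_exp.2 (hx hxA))

theorem map_gibbsWeight_empirical_univ [Nonempty X] (μ₀ : ProbabilityMeasure X) (β : ℝ) {N : ℕ}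
    (H : (Fin N → X) → ℝ) :
    (gibbsWeight μ₀ β H).map (empirical N) Set.univ = partitionFunction μ₀ β H := by
  rw [Measure.map_apply (measurable_empirical N) MeasurableSet.univ, Set.preimage_univ,
    gibbsWeight, withDensity_apply _ MeasurableSet.univ, Measure.restrict_univ, partitionFunction]

/-- `L^∞` convergence of the energies per particle gives an almost sure bound on the exponents. -/
theorem eventually_ae_abs_sub_le [Nonempty X] {μ₀ : ProbabilityMeasure X} (β : ℝ) {d : ℕ}
    {E : ProbabilityMeasure X → ℝ} {H : (n : ℕ) → (Fin (n ^ d) → X) → ℝ}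
    (hH : Tendsto (fun n : ℕ => eLpNorm
        (fun x : Fin (n ^ d) → X => H n x / (n : ℝ) ^ d - E (empirical (n ^ d) x))
        ∞ (prodMeasure μ₀ (n ^ d))) atTop (𝓝 0)) {δ : ℝ} (hδ : 0 < δ) :
    ∀ᶠ n : ℕ in atTop, ∀ᵐ x ∂prodMeasure μ₀ (n ^ d),
      |β * H n x - (n : ℝ) ^ d * (β * E (empirical (n ^ d) x))| ≤ (n : ℝ) ^ d * δ := by
  -- Adding 1 covers `β = 0`.
  have hs : 0 < δ / (|β| + 1) := by positivity
  filter_upwards [hH.eventually_le_const (ENNReal.ofReal_pos.2 hs), eventually_gt_atTop 0]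
    with n hn hn0
  rw [eLpNorm_exponent_top] at hn
  filter_upwards [enorm_ae_le_eLpNormEssSup (fun x : Fin (n ^ d) → X =>
    H n x / (n : ℝ) ^ d - E (empirical (n ^ d) x)) (prodMeasure μ₀ (n ^ d))] with x hx
  have hx' := hx.trans hn
  rw [← ofReal_norm, ENNReal.ofReal_le_ofReal_iff hs.le, Real.norm_eq_abs,
    le_div_iff₀ (by positivity)] at hx'
  have hN : (0 : ℝ) < (n : ℝ) ^ d := by positivity
  have h1 : β * H n x - (n : ℝ) ^ d * (β * E (empirical (n ^ d) x)) =
      (n : ℝ) ^ d * (β * (H n x / (n : ℝ) ^ d - E (empirical (n ^ d) x))) := by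
    field_simp
  rw [h1, abs_mul, abs_of_pos hN, abs_mul]
  refine mul_le_mul_of_nonneg_left (le_trans ?_ hx') hN.le
  rw [mul_comm]
  exact mul_le_mul_of_nonneg_left (by linarith) (abs_nonneg _)

variable [Nonempty X] [TopologicalSpace X] {μ₀ : ProbabilityMeasure X} {β : ℝ} {d : ℕ}
  {E : ProbabilityMeasure X → ℝ} {H : (n : ℕ) → (Fin (n ^ d) → X) → ℝ}

theorem exists_nhds_map_gibbsWeight_le [TopologicalSpace.PseudoMetrizableSpace X] [BorelSpace X]
    (hE : Continuous E)
    (hH : Tendsto (fun n : ℕ => eLpNorm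
        (fun x : Fin (n ^ d) → X => H n x / (n : ℝ) ^ d - E (empirical (n ^ d) x))
        ∞ (prodMeasure μ₀ (n ^ d))) atTop (𝓝 0)) (ν : ProbabilityMeasure X) (a : ℝ)
    (ha : (a : EReal) < ((β * E ν : ℝ) : EReal) + (Ent μ₀ ν : EReal)) :
    ∃ U ∈ 𝓝 ν, ∀ᶠ n : ℕ in atTop, (gibbsWeight μ₀ β (H n)).map (empirical (n ^ d)) U ≤
      ENNReal.ofReal (Real.exp (-((n : ℝ) ^ d * a))) := by
  have ha' : ((a - β * E ν : ℝ) : EReal) < (Ent μ₀ ν : EReal) := by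
    rw [EReal.coe_sub]
    exact EReal.sub_lt_of_lt_add' ha
  obtain ⟨c, hc, hcν⟩ := EReal.lt_iff_exists_real_btwn.1 ha'
  have hc' : a - β * E ν < c := by exact_mod_cast hc
  -- One `δ` is spent on the variation of `βE` near `ν`, the other on replacing `H / N` by `E`.
  set δ := (c - (a - β * E ν)) / 2 with hδ
  have hδ0 : 0 < δ := by linarith
  obtain ⟨U₁, hU₁, hU₁N⟩ := exists_nhds_prodMeasure_empirical_le hcν
  have hU₂ : {μ | β * E ν - δ < β * E μ} ∈ 𝓝 ν :=
    (isOpen_lt continuous_const (hE.const_mul β)).mem_nhds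
      (show β * E ν - δ < β * E ν by linarith)
  obtain ⟨V, hVU, hVm, hV⟩ := exists_measurableSet_mem_nhds (inter_mem hU₁ hU₂)
  refine ⟨V, hV, ?_⟩
  filter_upwards [eventually_ae_abs_sub_le β hH hδ0, eventually_ne_atTop 0] with n hn hn0
  have hN : (0 : ℝ) ≤ (n : ℝ) ^ d := by positivity
  rw [Measure.map_apply (measurable_empirical _) hVm]
  calc gibbsWeight μ₀ β (H n) (empirical (n ^ d) ⁻¹' V)
      ≤ ENNReal.ofReal (Real.exp ((n : ℝ) ^ d * (2 * δ - β * E ν)))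
          * prodMeasure μ₀ (n ^ d) (empirical (n ^ d) ⁻¹' V) := by
        refine gibbsWeight_le_exp_mul (measurable_empirical _ hVm) ?_
        filter_upwards [hn] with x hx hxV
        have h1 : β * E ν - δ < β * E (empirical (n ^ d) x) := (hVU hxV).2
        have h2 := (abs_le.1 hx).1
        have h3 := mul_le_mul_of_nonneg_left h1.le hN
        linarith
    _ ≤ ENNReal.ofReal (Real.exp ((n : ℝ) ^ d * (2 * δ - β * E ν)))
          * ENNReal.ofReal (Real.exp (-((n ^ d : ℕ) * c))) := by
        gcongr
        exact (measure_mono (Set.preimage_mono fun x hx => (hVU hx).1)).trans (hU₁N _ (pow_ne_zero d hn0))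
    _ = ENNReal.ofReal (Real.exp (-((n : ℝ) ^ d * a))) := by
        rw [← ENNReal.ofReal_mul (Real.exp_pos _).le, ← Real.exp_add]
        congr 2
        push_cast
        rw [hδ]; ring

theorem eventually_exp_le_map_gibbsWeight [OpensMeasurableSpace X] (hd : 0 < d) (hE : Continuous E)
    (hH : Tendsto (fun n : ℕ => eLpNorm
        (fun x : Fin (n ^ d) → X => H n x / (n : ℝ) ^ d - E (empirical (n ^ d) x))
        ∞ (prodMeasure μ₀ (n ^ d))) atTop (𝓝 0)) (ν : ProbabilityMeasure X) (a : ℝ)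
    (ha : ((β * E ν : ℝ) : EReal) + (Ent μ₀ ν : EReal) < (a : EReal))
    (U : Set (ProbabilityMeasure X)) (hU : U ∈ 𝓝 ν) :
    ∀ᶠ n : ℕ in atTop, ENNReal.ofReal (Real.exp (-((n : ℝ) ^ d * a))) ≤
      (gibbsWeight μ₀ β (H n)).map (empirical (n ^ d)) U := by
  have ha' : (Ent μ₀ ν : EReal) < ((a - β * E ν : ℝ) : EReal) := by
    rw [EReal.coe_sub, EReal.lt_sub_iff_add_lt (Or.inl (EReal.coe_ne_bot _))
      (Or.inl (EReal.coe_ne_top _)), add_comm]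
    exact ha
  obtain ⟨c, hνc, hc⟩ := EReal.lt_iff_exists_real_btwn.1 ha'
  have hc' : c < a - β * E ν := by exact_mod_cast hc
  set δ := (a - β * E ν - c) / 2 with hδ
  have hδ0 : 0 < δ := by linarith
  have hU₂ : {μ | β * E μ < β * E ν + δ} ∈ 𝓝 ν :=
    (isOpen_lt (hE.const_mul β) continuous_const).mem_nhds
      (show β * E ν < β * E ν + δ by linarith)
  obtain ⟨V, hVU, hVm, hV⟩ := exists_measurableSet_mem_nhds (inter_mem hU hU₂)
  -- Sanov's bound is used along the subsequence `N = n ^ d`, which is unbounded because `d > 0`.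
  have hsanov := (tendsto_pow_atTop (α := ℕ) hd.ne').eventually
    (eventually_exp_le_prodMeasure_empirical_mem hνc hV hVm)
  filter_upwards [eventually_ae_abs_sub_le β hH hδ0, hsanov] with n hn hn'
  have hN : (0 : ℝ) ≤ (n : ℝ) ^ d := by positivity
  refine le_trans ?_ (measure_mono fun μ hμ => (hVU hμ).1)
  rw [Measure.map_apply (measurable_empirical _) hVm]
  calc ENNReal.ofReal (Real.exp (-((n : ℝ) ^ d * a)))
      = ENNReal.ofReal (Real.exp ((n : ℝ) ^ d * (-(2 * δ) - β * E ν)))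
          * ENNReal.ofReal (Real.exp (-((n ^ d : ℕ) * c))) := by
        rw [← ENNReal.ofReal_mul (Real.exp_pos _).le, ← Real.exp_add]
        congr 2
        push_cast
        rw [hδ]; ring
    _ ≤ ENNReal.ofReal (Real.exp ((n : ℝ) ^ d * (-(2 * δ) - β * E ν)))
          * prodMeasure μ₀ (n ^ d) (empirical (n ^ d) ⁻¹' V) := by gcongr
    _ ≤ _ := by
        refine exp_mul_le_gibbsWeight (measurable_empirical _ hVm) ?_
        filter_upwards [hn] with x hx hxV
        have h1 : β * E (empirical (n ^ d) x) < β * E ν + δ := (hVU hxV).2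
        have h2 := (abs_le.1 hx).2
        have h3 := mul_le_mul_of_nonneg_left h1.le hN
        linarith

end Tilting

/-! ### Free energy and conclusion. -/

/-- The free energy functional has a finite infimum. -/
theorem exists_coe_eq_iInf_freeEnergy {X : Type*} [MeasurableSpace X] [TopologicalSpace X]
    [OpensMeasurableSpace X] [CompactSpace (ProbabilityMeasure X)] (μ₀ : ProbabilityMeasure X)
    (β : ℝ) {E : ProbabilityMeasure X → ℝ} (hE : Continuous E) :
    ∃ b : ℝ, (b : EReal) =
      ⨅ μ : ProbabilityMeasure X, (((β * E μ : ℝ) : EReal) + (Ent μ₀ μ : EReal)) := by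
  obtain ⟨K, hK⟩ := isCompact_univ.exists_bound_of_continuousOn (hE.const_mul β).continuousOn
  have hbot : ((-K : ℝ) : EReal) ≤
      ⨅ μ : ProbabilityMeasure X, (((β * E μ : ℝ) : EReal) + (Ent μ₀ μ : EReal)) := by
    refine le_iInf fun μ => ?_
    have h1 : -K ≤ β * E μ := (abs_le.1 (hK μ trivial)).1
    calc ((-K : ℝ) : EReal) ≤ ((β * E μ : ℝ) : EReal) := by exact_mod_cast h1
      _ ≤ _ := le_add_of_nonneg_right (EReal.coe_ennreal_nonneg _)
  have htop : ⨅ μ : ProbabilityMeasure X, (((β * E μ : ℝ) : EReal) + (Ent μ₀ μ : EReal)) ≤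
      ((β * E μ₀ : ℝ) : EReal) := by
    -- The measure `μ₀` itself has zero entropy.
    refine (iInf_le _ μ₀).trans (le_of_eq ?_)
    simp [Ent, InformationTheory.klDiv_self]
  exact ⟨_, EReal.coe_toReal (htop.trans_lt (EReal.coe_lt_top _)).ne
    ((EReal.bot_lt_coe _).trans_le hbot).ne'⟩

end GibbsLDP

/-- The large deviation principle for the Gibbs empirical measures. -/
theorem lemma8p1 {X : Type*} [MetricSpace X] [CompactSpace X] [Nonempty X]
    [MeasurableSpace X] [BorelSpace X]
    (μ₀ : ProbabilityMeasure X) (β : ℝ) (d : ℕ) (hd : 0 < d)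
    (E : ProbabilityMeasure X → ℝ) (hE : Continuous E)
    (H : (n : ℕ) → (Fin (n ^ d) → X) → ℝ)
    (hHmeas : ∀ n, AEMeasurable (H n) (GibbsLDP.prodMeasure μ₀ (n ^ d)))
    (hH : Tendsto
      (fun n : ℕ => eLpNorm
        (fun x : Fin (n ^ d) → X => H n x / (n : ℝ) ^ d - E (GibbsLDP.empirical (n ^ d) x))
        ∞ (GibbsLDP.prodMeasure μ₀ (n ^ d)))
      atTop (𝓝 0)) :
    ∃ C : ℝ,
      (C : EReal) = -(⨅ μ : ProbabilityMeasure X,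
        (((β * E μ : ℝ) : EReal) + (GibbsLDP.Ent μ₀ μ : EReal))) ∧
      Tendsto
        (fun n : ℕ => ((1 / (n : ℝ) ^ d : ℝ) : EReal) *
          ENNReal.log (GibbsLDP.partitionFunction μ₀ β (H n)))
        atTop (𝓝 (C : EReal)) ∧
      GibbsLDP.IsLDP (fun n : ℕ => GibbsLDP.gibbsEmpirical μ₀ β (H n))
        (fun n : ℕ => (n : ℝ) ^ d)
        (fun μ => ((β * E μ : ℝ) : EReal) + (GibbsLDP.Ent μ₀ μ : EReal) + (C : EReal)) := by
  obtain ⟨b, hb⟩ := GibbsLDP.exists_coe_eq_iInf_freeEnergy μ₀ β hE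
  have hmono : Monotone fun n : ℕ => (n : ℝ) ^ d := fun m n hmn => by
    have : (m : ℝ) ≤ n := by exact_mod_cast hmn
    dsimp only
    gcongr
  have hr : Tendsto (fun n : ℕ => (n : ℝ) ^ d) atTop atTop :=
    (tendsto_pow_atTop hd.ne').comp tendsto_natCast_atTop_atTop
  obtain ⟨hZ, hLDP⟩ := GibbsLDP.isLDP_normalized_of_local_bounds hmono hr
    (GibbsLDP.exists_nhds_map_gibbsWeight_le hE hH)
    (GibbsLDP.eventually_exp_le_map_gibbsWeight hd hE hH) hb
  simp_rw [GibbsLDP.map_gibbsWeight_empirical_univ] at hZ hLDP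
  exact ⟨-b, by rw [← hb, EReal.coe_neg], hZ, hLDP⟩
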